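/- For a nonzero integer $m$ let $A_m : y^2 = x^3 + m^2$ and $A'_m : y^2 = x^3 - 27m^2$, elliptic curves over $\mathbb{Q}$, and let $K = \mathbb{Q}(\sqrt{-3})$. For $F = \mathbb{Q}$ or $F = K$ let $S$ consist of the archimedean places of $F$ and the finite places of $F$ dividing $6m$, and let $F(S,3)$ be the group of classes $\overline{u} \in F^\times/(F^\times)^3$ such that $\mathrm{ord}_v(u) \equiv 0 \pmod 3$ for all $v \notin S$. The 3-descent maps are the homomorphisms $$\alpha : A_m(\mathbb{Q}) \to \mathbb{Q}(S,3), \qquad \alpha(O) = 1, \quad \alpha(0,m) = \tfrac{1}{2m}, \quad \alpha(x,y) = y - m \text{ otherwise},$$ $$\alpha' : A'_m(\mathbb{Q}) \to K(S,3), \qquad \alpha'(O) = 1, \quad \alpha'(x,y) = y - 3m\sqrt{-3}$$ (values are taken modulo cubes). Proposition. Let $p, q \geq 5$ be primes and let $m = pq$, so that $A_{pq} : y^2 = x^3 + p^2q^2$. (i) If each of $p$ and $q$ is congruent to $2$ or $-2$ modulo $9$, then $\mathbb{Z}/3\mathbb{Z} \leq \operatorname{im}\alpha \leq (\mathbb{Z}/3\mathbb{Z})^2$;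 that is, $\mathbb{Z}/3\mathbb{Z}$ embeds in the group $\operatorname{im}\alpha$, and $\operatorname{im}\alpha$ embeds in $(\mathbb{Z}/3\mathbb{Z})^2$. (ii) If $p \equiv 2 \pmod 3$ and $q \equiv 1 \pmod 3$, then $0 \leq \operatorname{im}\alpha' \leq \mathbb{Z}/3\mathbb{Z}$; that is, the group $\operatorname{im}\alpha'$ embeds in $\mathbb{Z}/3\mathbb{Z}$, and in particular has order at most $3$. -/

import Mathlib

open IsDedekindDomain

namespace ThreeDescent

noncomputable section

/-- The affine Weierstrass curve `y² = x³ + D` over `ℚ`. -/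
abbrev mordell (D : ℚ) : WeierstrassCurve.Affine ℚ := ⟨0, 0, 0, 0, D⟩

/-- The curve `A_m : y² = x³ + m²`. -/
abbrev curveA (m : ℤ) : WeierstrassCurve.Affine ℚ := mordell ((m : ℚ) ^ 2)

/-- The 3-isogenous curve `A'_m : y² = x³ - 27 m²`. -/
abbrev curveA' (m : ℤ) : WeierstrassCurve.Affine ℚ := mordell (-27 * (m : ℚ) ^ 2)

instance factNegThree : Fact (∀ r : ℚ, r ^ 2 ≠ -3 + 0 * r) :=
  ⟨fun r h => by nlinarith [sq_nonneg r]⟩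

/-- The field `K = ℚ(√-3)`, with elements `a + b√-3`. -/
abbrev QuadField : Type := QuadraticAlgebra ℚ (-3) 0

/-- The element `√-3` of `K`. -/
abbrev sqrtNegThree : QuadField := QuadraticAlgebra.omega

lemma sqrtNegThree_sq : sqrtNegThree ^ 2 = -3 := by
  rw [sq, QuadraticAlgebra.omega_mul_omega_eq_mk]
  ext <;> simp [QuadraticAlgebra.re_ofNat, QuadraticAlgebra.im_ofNat]

instance numberFieldQuadField : NumberField QuadField where
  to_charZero := inferInstance
  to_finiteDimensional := by
    have h : Module.Finite ℚ QuadField := inferInstance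
    convert h

/-- The finite places of the fraction field of `R` which divide `6m`. -/
def placesDividing (R : Type*) [CommRing R] (m : ℤ) : Set (HeightOneSpectrum R) :=
  {v | ((6 * m : ℤ) : R) ∈ v.asIdeal}

/-- The group `F(S, 3)`: the subgroup of `Fˣ/(Fˣ)³` of classes whose valuation is divisible by `3` at each
finite place outside `S`, for `F = Frac R` and `S` the set of all archimedean places together with
the finite places dividing `6m`. -/
abbrev classGroupS3 (R F : Type*) [CommRing R] [IsDedekindDomain R] [Field F] [Algebra R F]
    [IsFractionRing R F] (m : ℤ) : Subgroup (Fˣ ⧸ (powMonoidHom 3 : Fˣ →* Fˣ).range) :=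
  selmerGroup (R := R) (K := F) (S := placesDividing R m) (n := 3)

section Generic

variable {F : Type*} [Field F] [CharZero F] {D : ℚ}

open Classical in
/-- For `δ ∈ F` with `δ² = D`: the function on the rational points of `y² = x³ + D` sending `O` to
`1`, `(x, y)` to `y - δ` if `y ≠ δ`, and the point `(0, δ)` to `1 / (2δ)`. -/
def descentValue (D : ℚ) (δ : F) : (mordell D).Point → F
  | .zero => 1
  | .some _ y _ => if (y : F) = δ then 1 / (2 * δ) else (y : F) - δ

lemma descentValue_ne_zero {δ : F} (hδ : δ ≠ 0) (P : (mordell D).Point) :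
    descentValue D δ P ≠ 0 := by
  cases P with
  | zero => simp [descentValue]
  | some x y h =>
    simp only [descentValue]
    split_ifs with hy
    · simp [hδ]
    · exact sub_ne_zero.mpr hy

/-- The class of `descentValue D δ P` in `Fˣ/(Fˣ)³`. -/
def descentClass (D : ℚ) {δ : F} (hδ : δ ≠ 0) (P : (mordell D).Point) :
    Fˣ ⧸ (powMonoidHom 3 : Fˣ →* Fˣ).range :=
  QuotientGroup.mk (Units.mk0 (descentValue D δ P) (descentValue_ne_zero hδ P))

lemma equation_mordell {x y : ℚ} (h : (mordell D).Equation x y) : y ^ 2 = x ^ 3 + D := by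
  simpa using (WeierstrassCurve.Affine.equation_iff ..).mp h

lemma line_product {x₁ x₂ y₁ y₂ : ℚ} (h₁ : (mordell D).Equation x₁ y₁)
    (h₂ : (mordell D).Equation x₂ y₂) (hxy : ¬(x₁ = x₂ ∧ y₁ = (mordell D).negY x₂ y₂))
    {δ : F} (hδ : δ ^ 2 = (D : F)) :
    ∃ ν : F, ((y₁ : F) - δ) * (y₂ - δ) *
      (-(((mordell D).addY x₁ x₂ y₁ ((mordell D).slope x₁ x₂ y₁ y₂) : ℚ) : F) - δ) =
        (ν - δ) ^ 3 ∧
      ((y₁ : F) + δ) * (y₂ + δ) *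
      (-(((mordell D).addY x₁ x₂ y₁ ((mordell D).slope x₁ x₂ y₁ y₂) : ℚ) : F) + δ) =
        (ν + δ) ^ 3 := by
  have key := WeierstrassCurve.Affine.addPolynomial_slope h₁ h₂ hxy
  have hy₂ : y₂ = (mordell D).slope x₁ x₂ y₁ y₂ * (x₂ - x₁) + y₁ := by
    by_cases hx : x₁ = x₂
    · have hy : y₁ ≠ (mordell D).negY x₂ y₂ := fun h => hxy ⟨hx, h⟩
      have := WeierstrassCurve.Affine.Y_eq_of_Y_ne h₁ h₂ hx hy
      subst hx; rw [this]; ring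
    · rw [WeierstrassCurve.Affine.slope_of_X_ne hx]
      have := sub_ne_zero.mpr hx
      field_simp
      ring
  set l := (mordell D).slope x₁ x₂ y₁ y₂ with hl
  have hy₃ : (mordell D).addY x₁ x₂ y₁ l = -(l * ((mordell D).addX x₁ x₂ l - x₁) + y₁) := by
    simp [WeierstrassCurve.Affine.addY, WeierstrassCurve.Affine.negY,
      WeierstrassCurve.Affine.negAddY]
  have hx₃ : (mordell D).addX x₁ x₂ l = l ^ 2 - x₁ - x₂ := by
    simp [WeierstrassCurve.Affine.addX]
  rw [hx₃] at hy₃ key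
  have hev (t : ℚ) : (l * (t - x₁) + y₁) ^ 2 - (t ^ 3 + D) =
      -((t - x₁) * (t - x₂) * (t - (l ^ 2 - x₁ - x₂))) := by
    have := congrArg (Polynomial.eval t) key
    simp [WeierstrassCurve.Affine.addPolynomial, WeierstrassCurve.Affine.polynomial,
      WeierstrassCurve.Affine.linePolynomial] at this
    linear_combination this
  have e0 := hev 0
  have e1 := hev 1
  rw [hy₃]
  have f0 := congrArg (Rat.cast : ℚ → F) e0
  have f1 := congrArg (Rat.cast : ℚ → F) e1
  have f2 := congrArg (Rat.cast : ℚ → F) hy₂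
  push_cast at f0 f1 f2 ⊢
  have E3 : (x₁ : F) * x₂ * (l ^ 2 - x₁ - x₂) = (y₁ - l * x₁) ^ 2 - D := by
    linear_combination -f0
  have E2 : (x₁ : F) * x₂ + x₁ * (l ^ 2 - x₁ - x₂) + x₂ * (l ^ 2 - x₁ - x₂) =
      -2 * l * (y₁ - l * x₁) := by
    linear_combination f1 - f0
  refine ⟨y₁ - l * x₁, ?_, ?_⟩ <;> rw [f2]
  · linear_combination (l : F) ^ 3 * E3 + (l : F) ^ 2 * (y₁ - l * x₁ - δ) * E2 + (l : F) ^ 3 * hδ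
  · linear_combination (l : F) ^ 3 * E3 + (l : F) ^ 2 * (y₁ - l * x₁ + δ) * E2 + (l : F) ^ 3 * hδ

open Classical in
lemma exists_cube_relation_aux {δ x₂ y₁ y₂ y₃ ν : F} (hδ : δ ≠ 0)
    (h₂ : y₂ ^ 2 = x₂ ^ 3 + δ ^ 2)
    (hm : (y₁ - δ) * (y₂ - δ) * (-y₃ - δ) = (ν - δ) ^ 3)
    (hp : (y₁ + δ) * (y₂ + δ) * (-y₃ + δ) = (ν + δ) ^ 3) (e3 : ¬y₃ = δ) (e1 : y₁ = δ) :
    ∃ c : F, (if y₃ = δ then 1 / (2 * δ) else y₃ - δ) * c ^ 3 =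
      (if y₁ = δ then 1 / (2 * δ) else y₁ - δ) * (if y₂ = δ then 1 / (2 * δ) else y₂ - δ) := by
  have h2 : (2 : F) ≠ 0 := two_ne_zero
  have h2δ : 2 * δ ≠ 0 := mul_ne_zero h2 hδ
  subst e1
  have hν : ν = y₁ := by
    have : (ν - y₁) ^ 3 = 0 := by rw [← hm]; ring
    linear_combination pow_eq_zero_iff (three_ne_zero) |>.mp this
  subst hν
  have hr : (y₂ + ν) * (-y₃ + ν) = (2 * ν) ^ 2 := by
    apply mul_left_cancel₀ h2δ
    linear_combination hp
  by_cases e2 : y₂ = ν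
  · subst e2
    have hy : y₃ = -y₂ := by
      have : (2 * y₂) * (-y₃ + y₂) = (2 * y₂) * (2 * y₂) := by linear_combination hr
      linear_combination -(mul_left_cancel₀ h2δ this)
    subst hy
    simp only [if_neg e3, if_true]
    refine ⟨-1 / (2 * y₂), ?_⟩
    field_simp
    ring
  · simp only [if_neg e3, if_neg e2, if_true]
    have n2 : y₂ + ν ≠ 0 := by
      intro h
      rw [h, zero_mul] at hr
      exact pow_ne_zero 2 h2δ hr.symm
    have nx : x₂ ≠ 0 := by
      rintro rfl
      have : (y₂ - ν) * (y₂ + ν) = 0 := by linear_combination h₂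
      rcases mul_eq_zero.mp this with h | h
      · exact e2 (sub_eq_zero.mp h)
      · exact n2 h
    refine ⟨-x₂ / (2 * ν), ?_⟩
    field_simp
    apply mul_right_cancel₀ n2
    linear_combination x₂ ^ 3 * hr - 4 * ν ^ 2 * h₂

open Classical in
lemma exists_cube_relation {δ x₁ x₂ x₃ y₁ y₂ y₃ ν : F} (hδ : δ ≠ 0)
    (h₁ : y₁ ^ 2 = x₁ ^ 3 + δ ^ 2) (h₂ : y₂ ^ 2 = x₂ ^ 3 + δ ^ 2) (h₃ : y₃ ^ 2 = x₃ ^ 3 + δ ^ 2)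
    (hm : (y₁ - δ) * (y₂ - δ) * (-y₃ - δ) = (ν - δ) ^ 3)
    (hp : (y₁ + δ) * (y₂ + δ) * (-y₃ + δ) = (ν + δ) ^ 3) :
    ∃ c : F, (if y₃ = δ then 1 / (2 * δ) else y₃ - δ) * c ^ 3 =
      (if y₁ = δ then 1 / (2 * δ) else y₁ - δ) * (if y₂ = δ then 1 / (2 * δ) else y₂ - δ) := by
  have h2 : (2 : F) ≠ 0 := two_ne_zero
  have h2δ : 2 * δ ≠ 0 := mul_ne_zero h2 hδ
  by_cases e3 : y₃ = δ
  · subst e3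
    have hν : ν = -y₃ := by
      have : (ν + y₃) ^ 3 = 0 := by rw [← hp]; ring
      linear_combination pow_eq_zero_iff (three_ne_zero) |>.mp this
    subst hν
    have hne : (y₁ - y₃) * (y₂ - y₃) = (2 * y₃) ^ 2 := by
      apply mul_right_cancel₀ h2δ
      linear_combination -hm
    have n1 : y₁ ≠ y₃ := by
      rintro rfl
      exact pow_ne_zero 2 h2δ (by rw [← hne]; ring)
    have n2 : y₂ ≠ y₃ := by
      rintro rfl
      exact pow_ne_zero 2 h2δ (by rw [← hne]; ring)
    simp only [if_neg n1, if_neg n2, if_true]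
    refine ⟨2 * y₃, ?_⟩
    rw [hne]
    field_simp
  · by_cases e1 : y₁ = δ
    · exact exists_cube_relation_aux hδ h₂ hm hp e3 e1
    · by_cases e2 : y₂ = δ
      · obtain ⟨c, hc⟩ := exists_cube_relation_aux (ν := ν) hδ h₁ (by linear_combination hm)
          (by linear_combination hp) e3 e2
        exact ⟨c, by rw [hc, mul_comm]⟩
      · simp only [if_neg e3, if_neg e2, if_neg e1]
        by_cases e4 : y₃ = -δ
        · subst e4
          have hν : ν = δ := by
            have : (ν - δ) ^ 3 = 0 := by rw [← hm]; ring
            linear_combination pow_eq_zero_iff (three_ne_zero) |>.mp this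
          subst hν
          have hr : (y₁ + ν) * (y₂ + ν) = (2 * ν) ^ 2 := by
            apply mul_right_cancel₀ h2δ
            linear_combination hp
          refine ⟨-(x₁ * x₂) / (2 * ν), ?_⟩
          field_simp
          apply mul_right_cancel₀ (pow_ne_zero 2 h2δ)
          linear_combination 8 * ν ^ 2 * ((y₁ - ν) * (y₂ - ν) * hr -
            (y₂ ^ 2 - ν ^ 2) * h₁ - x₁ ^ 3 * h₂)
        · have nx : x₃ ≠ 0 := by
            rintro rfl
            have : (y₃ - δ) * (y₃ + δ) = 0 := by linear_combination h₃
            rcases mul_eq_zero.mp this with h | h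
            · exact e3 (sub_eq_zero.mp h)
            · exact e4 (by linear_combination h)
          refine ⟨-(ν - δ) / x₃, ?_⟩
          have n4 : y₃ + δ ≠ 0 := fun h => e4 (by linear_combination h)
          field_simp
          apply mul_right_cancel₀ n4
          linear_combination x₃ ^ 3 * hm - (ν - δ) ^ 3 * h₃

lemma mk_eq_mk_of_cube {F : Type*} [Field F] {u w : Fˣ} {c : F} (h : (u : F) * c ^ 3 = w) :
    (QuotientGroup.mk u : Fˣ ⧸ (powMonoidHom 3 : Fˣ →* Fˣ).range) = QuotientGroup.mk w := by
  have hc : c ≠ 0 := by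
    rintro rfl
    exact w.ne_zero (by rw [← h]; simp)
  refine QuotientGroup.eq.mpr ⟨Units.mk0 c hc, ?_⟩
  rw [powMonoidHom_apply, eq_inv_mul_iff_mul_eq]
  ext
  simpa using h

lemma descentClass_add {δ : F} (hδ : δ ≠ 0) (hD : δ ^ 2 = (D : F)) (P Q : (mordell D).Point) :
    descentClass D hδ (P + Q) = descentClass D hδ P * descentClass D hδ Q := by
  suffices h : ∃ c : F, descentValue D δ (P + Q) * c ^ 3 =
      descentValue D δ P * descentValue D δ Q by
    obtain ⟨c, hc⟩ := h
    rw [descentClass, descentClass, descentClass, ← QuotientGroup.mk_mul]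
    exact mk_eq_mk_of_cube (c := c) (by simpa using hc)
  have hcast {x y : ℚ} (h : (mordell D).Nonsingular x y) : (y : F) ^ 2 = (x : F) ^ 3 + δ ^ 2 := by
    rw [hD]; exact_mod_cast congrArg (Rat.cast : ℚ → F) (equation_mordell h.1)
  cases P with
  | zero =>
    refine ⟨1, ?_⟩
    rw [← WeierstrassCurve.Affine.Point.zero_def, zero_add]
    simp [descentValue]
  | some x₁ y₁ h₁ =>
    cases Q with
    | zero =>
      refine ⟨1, ?_⟩
      rw [← WeierstrassCurve.Affine.Point.zero_def, add_zero]
      simp [descentValue]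
    | some x₂ y₂ h₂ =>
      by_cases hxy : x₁ = x₂ ∧ y₁ = (mordell D).negY x₂ y₂
      · rw [WeierstrassCurve.Affine.Point.add_of_Y_eq hxy.1 hxy.2,
          WeierstrassCurve.Affine.Point.zero_def]
        obtain ⟨rfl, hy⟩ := hxy
        have hy' : y₁ = -y₂ := by simpa [WeierstrassCurve.Affine.negY] using hy
        subst hy'
        have e := hcast h₂
        have hs : -δ ≠ δ := fun h => hδ (by linear_combination (-1 / 2 : F) * h)
        simp only [descentValue, one_mul]
        rw [Rat.cast_neg]
        by_cases a : (y₂ : F) = δ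
        · refine ⟨-1, ?_⟩
          rw [a, if_pos rfl, if_neg hs]
          field_simp
          ring
        · by_cases b : -(y₂ : F) = δ
          · refine ⟨-1, ?_⟩
            have b' : (y₂ : F) = -δ := by linear_combination -b
            rw [if_pos b, if_neg a, b']
            field_simp
            ring
          · refine ⟨-x₁, ?_⟩
            rw [if_neg a, if_neg b]
            linear_combination e
      · rw [WeierstrassCurve.Affine.Point.add_some hxy]
        obtain ⟨ν, hm, hp⟩ := line_product h₁.1 h₂.1 hxy hD
        exact exists_cube_relation hδ (hcast h₁) (hcast h₂)
          (hcast (WeierstrassCurve.Affine.nonsingular_add h₁ h₂ hxy)) hm hp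

end Generic

section Selmer

variable {R F : Type*} [CommRing R] [IsDedekindDomain R] [Field F] [Algebra R F]
    [IsFractionRing R F]

lemma valuationOfNeZeroMod_eq_one (v : HeightOneSpectrum R) (u : Fˣ) (z : Multiplicative ℤ)
    (h : v.valuationOfNeZero u = z ^ 3) :
    v.valuationOfNeZeroMod 3 (QuotientGroup.mk u) = 1 := by
  have h1 : v.valuationOfNeZeroMod 3 (QuotientGroup.mk u) = Multiplicative.ofAdd
      (((v.valuationOfNeZero u).toAdd : ℤ) : ZMod 3) := rfl
  rw [h1, h, toAdd_pow]
  have h3 : (3 : ZMod 3) = 0 := rfl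
  simp [h3]

lemma valuationOfNeZero_cube (v : HeightOneSpectrum R) (u w d : Fˣ) (x : F)
    (hx : (u : F) * w = x ^ 3) (hd : v.valuation F d = 1) (h : (w : F) = u + d) :
    ∃ z : Multiplicative ℤ, v.valuationOfNeZero u = z ^ 3 := by
  have hx0 : x ≠ 0 := by
    rintro rfl
    exact (u * w).ne_zero (by push_cast; rw [hx]; simp)
  have hx' : u * w = (Units.mk0 x hx0) ^ 3 := by ext; simpa using hx
  have hv := congrArg v.valuationOfNeZero hx'
  rw [map_mul, map_pow] at hv
  rcases lt_trichotomy (v.valuation F (u : F)) 1 with hu | hu | hu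
  · have hw : v.valuationOfNeZero w = 1 := by
      rw [← WithZero.coe_inj, HeightOneSpectrum.valuationOfNeZero_eq, h,
        Valuation.map_add_eq_of_lt_right _ (by rw [hd]; exact hu), hd]
      rfl
    exact ⟨_, by rw [← hv, hw, mul_one]⟩
  · refine ⟨1, ?_⟩
    rw [← WithZero.coe_inj, HeightOneSpectrum.valuationOfNeZero_eq, hu]
    rfl
  · have hw : v.valuationOfNeZero w = v.valuationOfNeZero u := by
      rw [← WithZero.coe_inj, HeightOneSpectrum.valuationOfNeZero_eq,
        HeightOneSpectrum.valuationOfNeZero_eq, h,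
        Valuation.map_add_eq_of_lt_left _ (by rw [hd]; exact hu)]
    refine ⟨v.valuationOfNeZero u / v.valuationOfNeZero (Units.mk0 x hx0), ?_⟩
    rw [div_pow, ← hv, hw, eq_div_iff_mul_eq', pow_succ, sq, mul_assoc]

lemma descentClass_mem [CharZero F] {D : ℚ} {δ : F} (hδ : δ ≠ 0) (hD : δ ^ 2 = (D : F)) (m : ℤ)
    (hm : ∀ v : HeightOneSpectrum R, v ∉ placesDividing R m → v.valuation F (2 * δ) = 1)
    (P : (mordell D).Point) : descentClass D hδ P ∈ classGroupS3 R F m := by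
  intro v hv
  have hd := hm v hv
  have h2δ : 2 * δ ≠ 0 := mul_ne_zero two_ne_zero hδ
  obtain ⟨z, hz⟩ : ∃ z : Multiplicative ℤ, v.valuationOfNeZero
      (Units.mk0 (descentValue D δ P) (descentValue_ne_zero hδ P)) = z ^ 3 := by
    have one_case {u : Fˣ} (h : v.valuation F (u : F) = 1) :
        ∃ z : Multiplicative ℤ, v.valuationOfNeZero u = z ^ 3 := by
      refine ⟨1, ?_⟩
      rw [← WithZero.coe_inj, HeightOneSpectrum.valuationOfNeZero_eq, h]
      rfl
    cases P with
    | zero => exact one_case (by simp [descentValue])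
    | some x y h =>
      by_cases hy : (y : F) = δ
      · refine one_case ?_
        simp only [Units.val_mk0, descentValue, if_pos hy]
        rw [map_div₀, hd, map_one, div_one]
      · by_cases hy' : (y : F) + δ = 0
        · refine one_case ?_
          simp only [Units.val_mk0, descentValue, if_neg hy]
          rw [show (y : F) - δ = -(2 * δ) by linear_combination hy', Valuation.map_neg, hd]
        · have e : (y : F) ^ 2 = (x : F) ^ 3 + δ ^ 2 := by
            rw [hD]; exact_mod_cast congrArg (Rat.cast : ℚ → F) (equation_mordell h.1)
          refine valuationOfNeZero_cube v _ (Units.mk0 _ hy') (Units.mk0 _ h2δ) x ?_ hd ?_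
          · simp only [Units.val_mk0, descentValue, if_neg hy]
            linear_combination e
          · simp only [Units.val_mk0, descentValue, if_neg hy]
            ring
  exact valuationOfNeZeroMod_eq_one v _ z hz

/-- The descent map from the rational points of `y² = x³ + D` to `F(S, 3)`, given by
`P ↦ descentValue D δ P`, where `δ ∈ F`, `δ² = D ≠ 0` and `2δ` is a unit outside `S`. -/
def descentHom (R : Type*) {F : Type*} [CommRing R] [IsDedekindDomain R] [Field F] [CharZero F]
    [Algebra R F] [IsFractionRing R F] {D : ℚ} {δ : F} (hδ : δ ≠ 0) (hD : δ ^ 2 = (D : F)) (m : ℤ)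
    (hm : ∀ v : HeightOneSpectrum R, v ∉ placesDividing R m → v.valuation F (2 * δ) = 1) :
    (mordell D).Point →+ Additive (classGroupS3 R F m) where
  toFun P := Additive.ofMul ⟨descentClass D hδ P, descentClass_mem hδ hD m hm P⟩
  map_zero' := by
    have h : Units.mk0 (descentValue D δ 0) (descentValue_ne_zero hδ 0) = 1 := by
      ext
      rfl
    exact congrArg Additive.ofMul (Subtype.ext (congrArg QuotientGroup.mk h))
  map_add' P Q := congrArg Additive.ofMul (Subtype.ext (descentClass_add hδ hD P Q))

lemma valuation_six_mul {m : ℤ} {v : HeightOneSpectrum R} (hv : v ∉ placesDividing R m) :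
    v.valuation F (6 * m) = 1 := by
  have h : v.valuation F (algebraMap R F ((6 * m : ℤ) : R)) = 1 := by
    refine le_antisymm (v.valuation_le_one _) (not_lt.mp fun h => hv ?_)
    rw [HeightOneSpectrum.valuation_lt_one_iff_mem] at h
    exact h
  rw [map_intCast] at h
  exact_mod_cast h

lemma valuation_intCast_eq_one {m a b : ℤ} {v : HeightOneSpectrum R}
    (hv : v ∉ placesDividing R m) (hab : a * b = 6 * m) : v.valuation F (a : F) = 1 := by
  have h := valuation_six_mul (F := F) hv
  have h' : v.valuation F (a : F) * v.valuation F (b : F) = 1 := by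
    rw [← map_mul, ← h]
    exact congrArg _ (by exact_mod_cast congrArg (Int.cast : ℤ → F) hab)
  have ha : v.valuation F (a : F) ≤ 1 := by simpa using v.valuation_le_one (K := F) (a : R)
  have hb : v.valuation F (b : F) ≤ 1 := by simpa using v.valuation_le_one (K := F) (b : R)
  refine le_antisymm ha (not_lt.mp fun hlt => ?_)
  exact absurd h' (ne_of_lt (mul_lt_one_of_lt_of_le hlt hb))

end Selmer

/-- The 3-descent map `α` on `A_m(ℚ)`, with values in `ℚ(S, 3)`: it sends `O` to `1`, `(0, m)` to
`1 / (2m)`, and any other `(x, y)` to `y - m`. -/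
def alpha (m : ℤ) (hm : m ≠ 0) : (curveA m).Point →+ Additive (classGroupS3 ℤ ℚ m) :=
  descentHom ℤ (δ := (m : ℚ)) (by exact_mod_cast hm) (by simp) m fun v hv => by
    exact_mod_cast valuation_intCast_eq_one (F := ℚ) (a := 2 * m) (b := 3) hv (by ring)

/-- The 3-descent map `α'` on `A'_m(ℚ)`, with values in `K(S, 3)` where `K = ℚ(√-3)`: it sends `O`
to `1` and `(x, y)` to `y - 3m√-3` (as `3m√-3` is not rational, `y ≠ 3m√-3` always holds). -/
def alpha' (m : ℤ) (hm : m ≠ 0) :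
    (curveA' m).Point →+ Additive (classGroupS3 (NumberField.RingOfIntegers QuadField) QuadField m) :=
  descentHom (NumberField.RingOfIntegers QuadField) (δ := 3 * (m : QuadField) * sqrtNegThree)
    (mul_ne_zero (mul_ne_zero three_ne_zero (by exact_mod_cast hm)) (fun h => by
      have := sqrtNegThree_sq
      rw [h] at this
      norm_num at this))
    (by push_cast; rw [mul_pow, sqrtNegThree_sq]; ring) m fun v hv => by
    have h3 := valuation_intCast_eq_one (F := QuadField) (a := 3) (b := 2 * m) hv (by ring)
    have h6 := valuation_six_mul (F := QuadField) hv
    have hs : (v.valuation QuadField sqrtNegThree) ^ 2 = 1 := by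
      rw [← map_pow, sqrtNegThree_sq, Valuation.map_neg]
      exact_mod_cast h3
    have hs' : v.valuation QuadField sqrtNegThree = 1 :=
      (pow_eq_one_iff_of_nonneg zero_le two_ne_zero).mp hs
    rw [show (2 * (3 * (m : QuadField) * sqrtNegThree)) = 6 * m * sqrtNegThree by ring, map_mul,
      h6, hs', one_mul]

lemma mul_primes_ne_zero {p q : ℕ} (hp : p.Prime) (hq : q.Prime) : (p * q : ℤ) ≠ 0 := by
  exact_mod_cast mul_ne_zero hp.ne_zero hq.ne_zero

end

end ThreeDescent

/-! A class in F(S, 3) is controlled by its valuations modulo 3, and the product of the descent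
value u with its partner (y + m, or the conjugate) is the cube x³. So few valuations are free, and
once those vanish modulo 3 only a small factor separates u from a cube. A congruence obstruction
removes that factor.

Part (i). For y ≠ ±m, the factors y - m and y + m differ by 2m and multiply to x³, so at a prime not
dividing 2m, 3 included, the valuation of y - m is divisible by 3; the exceptional points are
checked directly. If this also holds at p and q, then u is 1, 2 or 4 times a cube
(`exists_two_pow_mul_cube`). The factors 2 and 4 lead to a rational solution of e³ = 4c³ + 4m,
impossible modulo 9 because m ≡ ±4 (`rat_cube_ne`). So the valuations at p and q embed im α in
(ℤ/3ℤ)². Conversely α(0, m) = 1/(2m) has 2-adic order -1, so it is a nontrivial class of order 3.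

Part (ii). Here u times its conjugate is x³. The places above 2, 3 and p are stable under
conjugation, so twice the valuation of u there is divisible by 3 (`isCubeAt_of_valuation_eq`). The
places above q are conjugate, so one of them determines whether 3 divides the valuation at all of
them. If it does, class number one and the units of ℚ(ζ₃) give u = ζc³ with ζ³ = 1
(`exists_root_mul_cube`). For ζ ≠ 1 the coefficient -3m of √-3 in u yields a rational solution of A³
- 3A²B + B³ = ±6m, impossible 2-adically for odd m (`rat_binary_cubic_ne`). -/

namespace ThreeDescent

/-! ### Valuations modulo 3, and cubes up to units over a principal ideal domain. -/

section Valuation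

variable {R F : Type*} [CommRing R] [IsDedekindDomain R] [Field F] [Algebra R F]
    [IsFractionRing R F]

/-- The `v`-adic valuation of `u` is divisible by `3`. -/
def IsCubeAt (v : HeightOneSpectrum R) (u : Fˣ) : Prop :=
  ∃ z : Multiplicative ℤ, v.valuationOfNeZero u = z ^ 3

lemma IsCubeAt.mul {v : HeightOneSpectrum R} {u w : Fˣ} (hu : IsCubeAt v u) (hw : IsCubeAt v w) :
    IsCubeAt v (u * w) := by
  obtain ⟨a, ha⟩ := hu
  obtain ⟨b, hb⟩ := hw
  exact ⟨a * b, by rw [map_mul, ha, hb, mul_pow]⟩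

lemma IsCubeAt.inv {v : HeightOneSpectrum R} {u : Fˣ} (hu : IsCubeAt v u) :
    IsCubeAt v u⁻¹ := by
  obtain ⟨a, ha⟩ := hu
  exact ⟨a⁻¹, by rw [map_inv, ha, inv_pow]⟩

lemma isCubeAt_pow_three (v : HeightOneSpectrum R) (u : Fˣ) : IsCubeAt v (u ^ 3) :=
  ⟨v.valuationOfNeZero u, map_pow ..⟩

lemma isCubeAt_of_valuation_eq_one {v : HeightOneSpectrum R} {u : Fˣ}
    (h : v.valuation F (u : F) = 1) : IsCubeAt v u := by
  refine ⟨1, ?_⟩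
  rw [← WithZero.coe_inj, HeightOneSpectrum.valuationOfNeZero_eq, h]
  rfl

lemma valuationOfNeZeroMod_mk (v : HeightOneSpectrum R) (u : Fˣ) :
    v.valuationOfNeZeroMod 3 (QuotientGroup.mk u) = Multiplicative.ofAdd
      (((v.valuationOfNeZero u).toAdd : ℤ) : ZMod 3) := rfl

lemma valuationOfNeZeroMod_eq_one_iff (v : HeightOneSpectrum R) (u : Fˣ) :
    v.valuationOfNeZeroMod 3 (QuotientGroup.mk u) = 1 ↔ IsCubeAt v u := by
  refine ⟨fun h => ?_, fun ⟨z, hz⟩ => valuationOfNeZeroMod_eq_one v u z hz⟩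
  rw [valuationOfNeZeroMod_mk, ofAdd_eq_one, ZMod.intCast_zmod_eq_zero_iff_dvd] at h
  obtain ⟨k, hk⟩ := h
  refine ⟨Multiplicative.ofAdd k, ?_⟩
  rw [← ofAdd_nsmul, ← ofAdd_toAdd (v.valuationOfNeZero u), hk]
  simp

lemma isCubeAt_of_mul_eq_cube {v : HeightOneSpectrum R} {u w : Fˣ} {x : F}
    (hx : (u : F) * w = x ^ 3) (hu : IsCubeAt v u) : IsCubeAt v w := by
  have hx0 : x ≠ 0 := by
    rintro rfl
    exact (u * w).ne_zero (by push_cast; rw [hx]; simp)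
  have hx' : w = (Units.mk0 x hx0) ^ 3 * u⁻¹ := by
    rw [eq_mul_inv_iff_mul_eq, mul_comm]
    ext
    simpa using hx
  rw [hx']
  exact (isCubeAt_pow_three v _).mul hu.inv

/-- Additively 2v(u) = 3v(x), so v(u) = 3(v(u) - v(x)). This serves the places fixed by conjugation.
-/
lemma isCubeAt_of_valuation_eq {v : HeightOneSpectrum R} {u w : Fˣ} {x : F}
    (hx : (u : F) * w = x ^ 3) (h : v.valuation F (u : F) = v.valuation F (w : F)) :
    IsCubeAt v u := by
  have hx0 : x ≠ 0 := by
    rintro rfl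
    exact (u * w).ne_zero (by push_cast; rw [hx]; simp)
  have hx' : u * w = (Units.mk0 x hx0) ^ 3 := by ext; simpa using hx
  have hv := congrArg v.valuationOfNeZero hx'
  have h' : v.valuationOfNeZero w = v.valuationOfNeZero u := by
    rw [← WithZero.coe_inj, HeightOneSpectrum.valuationOfNeZero_eq,
        HeightOneSpectrum.valuationOfNeZero_eq, h]
  rw [map_mul, map_pow, h'] at hv
  refine ⟨v.valuationOfNeZero u / v.valuationOfNeZero (Units.mk0 x hx0), ?_⟩
  rw [div_pow, ← hv, eq_div_iff_mul_eq', pow_succ, pow_two, mul_assoc]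

/-- Only 2δ being a unit at v matters. Over ℚ this also covers places of S such as 3, where
membership in F(S, 3) gives nothing. -/
lemma isCubeAt_descentValue [CharZero F] {D : ℚ} {δ : F} (hδ : δ ≠ 0) (hD : δ ^ 2 = (D : F))
    {v : HeightOneSpectrum R} (hd : v.valuation F (2 * δ) = 1) (P : (mordell D).Point) :
    IsCubeAt v (Units.mk0 (descentValue D δ P) (descentValue_ne_zero hδ P)) := by
  have h2δ : 2 * δ ≠ 0 := mul_ne_zero two_ne_zero hδ
  cases P with
  | zero => exact isCubeAt_of_valuation_eq_one (by simp [descentValue])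
  | some x y h =>
    by_cases hy : (y : F) = δ
    · refine isCubeAt_of_valuation_eq_one ?_
      simp only [Units.val_mk0, descentValue, if_pos hy]
      rw [map_div₀, hd, map_one, div_one]
    · by_cases hy' : (y : F) + δ = 0
      · refine isCubeAt_of_valuation_eq_one ?_
        simp only [Units.val_mk0, descentValue, if_neg hy]
        rw [show (y : F) - δ = -(2 * δ) by linear_combination hy', Valuation.map_neg, hd]
      · have e : (y : F) ^ 2 = (x : F) ^ 3 + δ ^ 2 := by
          rw [hD]; exact_mod_cast congrArg (Rat.cast : ℚ → F) (equation_mordell h.1)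
        refine valuationOfNeZero_cube v _ (Units.mk0 _ hy') (Units.mk0 _ h2δ) x ?_ hd ?_
        · simp only [Units.val_mk0, descentValue, if_neg hy]
          linear_combination e
        · simp only [Units.val_mk0, descentValue, if_neg hy]
          ring

/-- Two height one primes of which one contains the other are equal. -/
lemma heightOneSpectrum_eq_of_le {v w : HeightOneSpectrum R} (h : v.asIdeal ≤ w.asIdeal) : v = w :=
  HeightOneSpectrum.ext (v.isMaximal.eq_of_le w.isPrime.ne_top h)

lemma exists_heightOneSpectrum_of_prime {R : Type*} [CommRing R] {π : R} (hπ : Prime π) :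
    ∃ v : HeightOneSpectrum R, v.asIdeal = Ideal.span {π} :=
  ⟨⟨Ideal.span {π}, (Ideal.span_singleton_prime hπ.ne_zero).mpr hπ,
    by simpa using hπ.ne_zero⟩, rfl⟩

/-- A prime dividing r has positive valuation divisible by 3, so its cube divides r and can be split
off; induction is on proper divisibility. -/
lemma exists_associated_cube [IsPrincipalIdealRing R] (r : R) (hr : r ≠ 0)
    (h : ∀ (v : HeightOneSpectrum R), ∃ k : ℕ, v.intValuation r = WithZero.exp (-((3 * k : ℕ) : ℤ))) :
    ∃ (ε : Rˣ) (c : R), r = ε * c ^ 3 := by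
  induction r using WellFounded.induction (wellFounded_dvdNotUnit (α := R)) with
  | _ r ih =>
    by_cases hu : IsUnit r
    · exact ⟨hu.unit, 1, by simp⟩
    · obtain ⟨π, hπ, hdvd⟩ := WfDvdMonoid.exists_irreducible_factor hu hr
      have hπ' := hπ.prime
      obtain ⟨v, hv⟩ := exists_heightOneSpectrum_of_prime hπ'
      have hd : π ^ 3 ∣ r := by
        obtain ⟨k, hk⟩ := h v
        have hlt := (v.intValuation_lt_one_iff_mem r).mpr
          (by rw [hv]; exact Ideal.mem_span_singleton.mpr hdvd)
        have hk0 : k ≠ 0 := by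
          rintro rfl
          simp [hk] at hlt
        have := (v.intValuation_le_pow_iff_mem r 3).mp (by
          rw [hk, WithZero.exp_le_exp]; push_cast; omega)
        rwa [hv, Ideal.span_singleton_pow, Ideal.mem_span_singleton] at this
      obtain ⟨s, rfl⟩ := hd
      have hs : s ≠ 0 := right_ne_zero_of_mul hr
      obtain ⟨ε, c, hc⟩ := ih s ⟨hs, π ^ 3, fun hh => hπ.not_isUnit (isUnit_pow_iff (by simp) |>.mp hh),
        mul_comm ..⟩ hs (fun w => by
          obtain ⟨k, hk⟩ := h w
          rw [map_mul, map_pow] at hk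
          have e1 := w.intValuation_eq_exp_neg_multiplicity hπ'.ne_zero
          have e2 := w.intValuation_eq_exp_neg_multiplicity hs
          rw [e1, e2, ← WithZero.exp_nsmul, ← WithZero.exp_add, WithZero.exp_inj] at hk
          rw [e2]
          refine ⟨k - multiplicity w.asIdeal (Ideal.span {π}), ?_⟩
          congr 1
          simp only [nsmul_eq_mul] at hk
          push_cast at hk ⊢
          omega)
      exact ⟨ε, π * c, by rw [hc]; ring⟩

lemma exists_unit_mul_cube [IsPrincipalIdealRing R] (u : Fˣ)
    (h : ∀ v : HeightOneSpectrum R, IsCubeAt v u) :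
    ∃ (ε : Rˣ) (c : F), (u : F) = algebraMap R F ε * c ^ 3 := by
  obtain ⟨a, b, hb, hab⟩ := IsFractionRing.div_surjective (A := R) (u : F)
  have hb0 : b ≠ 0 := nonZeroDivisors.ne_zero hb
  have hbF : algebraMap R F b ≠ 0 := by simpa using hb0
  have ha0 : a ≠ 0 := by
    rintro rfl
    exact u.ne_zero (by rw [← hab]; simp)
  have hr : a * b ^ 2 ≠ 0 := mul_ne_zero ha0 (pow_ne_zero 2 hb0)
  -- Since a/b = ab²/b³, the integral element ab² has the same valuations modulo 3 as u.
  obtain ⟨ε, c, hc⟩ := exists_associated_cube (a * b ^ 2) hr (fun v => by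
    obtain ⟨z, hz⟩ := (h v).mul (isCubeAt_pow_three v (Units.mk0 _ hbF))
    have hz' := HeightOneSpectrum.valuationOfNeZero_eq v (u * Units.mk0 _ hbF ^ 3)
    have e : ((u * Units.mk0 _ hbF ^ 3 : Fˣ) : F) = algebraMap R F (a * b ^ 2) := by
      rw [Units.val_mul, Units.val_pow_eq_pow_val, Units.val_mk0, ← hab, map_mul, map_pow]
      field_simp
    rw [e, HeightOneSpectrum.valuation_of_algebraMap, hz,
      v.intValuation_eq_exp_neg_multiplicity hr] at hz'
    have hz2 : WithZero.exp (3 * z.toAdd) =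
      WithZero.exp (-(multiplicity v.asIdeal (Ideal.span {a * b ^ 2}) : ℤ)) := by
      rw [← hz']
      congr 1
    rw [WithZero.exp_inj] at hz2
    rw [v.intValuation_eq_exp_neg_multiplicity hr]
    refine ⟨(-z.toAdd).toNat, ?_⟩
    congr 1
    push_cast
    omega)
  refine ⟨ε, algebraMap R F c / algebraMap R F b, ?_⟩
  have := congrArg (algebraMap R F) hc
  simp only [map_mul, map_pow] at this
  rw [div_pow, mul_div_assoc', ← this, ← hab]
  field_simp

/-- The valuation at `v` modulo `3`, as a homomorphism on `F(S, 3)`. -/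
noncomputable def valuationModThree (m : ℤ) (v : HeightOneSpectrum R) :
    Additive (classGroupS3 R F m) →+ ZMod 3 :=
  MonoidHom.toAdditiveLeft ((v.valuationOfNeZeroMod 3).comp (classGroupS3 R F m).subtype)

lemma valuationModThree_eq_zero_iff {m : ℤ} (v : HeightOneSpectrum R) {u : Fˣ}
    (hu : QuotientGroup.mk u ∈ classGroupS3 R F m) :
    valuationModThree m v (Additive.ofMul ⟨QuotientGroup.mk u, hu⟩) = 0 ↔ IsCubeAt v u :=
  valuationOfNeZeroMod_eq_one_iff v u

lemma descentClass_eq_one_of_cube [CharZero F] {D : ℚ} {δ : F} (hδ : δ ≠ 0)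
    (P : (mordell D).Point) {c : F} (h : descentValue D δ P = c ^ 3) : descentClass D hδ P = 1 := by
  rw [descentClass, ← QuotientGroup.mk_one]
  exact (mk_eq_mk_of_cube (c := c) (by simpa using h.symm)).symm

end Valuation

/-! ### The map α over ℚ. -/

section Rational

/-- Cubes modulo 9 are 0 and ±1, and 4m ≡ ±2. The terms are thus 0 or ±1, 0 or ±4, and 0 or ±2,
which cancel modulo 9 only if all vanish. In `ZMod 9`, 3t = 0 encodes 3 ∣ t. -/
lemma three_dvd_of_cube_eq {m e c w : ℤ} (hm : m ≡ 4 [ZMOD 9] ∨ m ≡ -4 [ZMOD 9])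
    (h : e ^ 3 = 4 * c ^ 3 + 4 * m * w ^ 3) : 3 ∣ e ∧ 3 ∣ c ∧ 3 ∣ w := by
  have key : ∀ n : ZMod 9, (n = 4 ∨ n = -4) → ∀ e c w : ZMod 9, e ^ 3 = 4 * c ^ 3 + 4 * n * w ^ 3 →
      3 * e = 0 ∧ 3 * c = 0 ∧ 3 * w = 0 := by
    rintro n (rfl | rfl) <;> decide +kernel
  have hdvd (t : ℤ) (ht : (3 : ZMod 9) * t = 0) : 3 ∣ t := by
    have : ((3 * t : ℤ) : ZMod 9) = 0 := by push_cast; exact ht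
    rw [ZMod.intCast_zmod_eq_zero_iff_dvd] at this
    omega
  have hm' : (m : ZMod 9) = 4 ∨ (m : ZMod 9) = -4 := by
    rcases hm with hm | hm
    · exact Or.inl (by exact_mod_cast (ZMod.intCast_eq_intCast_iff _ _ 9).mpr hm)
    · exact Or.inr (by exact_mod_cast (ZMod.intCast_eq_intCast_iff _ _ 9).mpr hm)
  obtain ⟨a, b, d⟩ := key m hm' e c w (by exact_mod_cast congrArg (Int.cast : ℤ → ZMod 9) h)
  exact ⟨hdvd e a, hdvd c b, hdvd w d⟩

lemma int_cube_ne {m : ℤ} (hm : m ≡ 4 [ZMOD 9] ∨ m ≡ -4 [ZMOD 9]) (w : ℤ) (hw : w ≠ 0) (e c : ℤ) :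
    e ^ 3 ≠ 4 * c ^ 3 + 4 * m * w ^ 3 := by
  induction hn : w.natAbs using Nat.strong_induction_on generalizing w e c with
  | _ n ih =>
    intro h
    obtain ⟨⟨e, rfl⟩, ⟨c, rfl⟩, ⟨w, rfl⟩⟩ := three_dvd_of_cube_eq hm h
    exact ih w.natAbs (by omega) w (by omega) e c rfl (by linarith)

lemma rat_cube_ne {m : ℤ} (hm : m ≡ 4 [ZMOD 9] ∨ m ≡ -4 [ZMOD 9]) (e c : ℚ) :
    e ^ 3 ≠ 4 * c ^ 3 + 4 * m := by
  intro h
  refine int_cube_ne hm (e.den * c.den) (by positivity) (e.num * c.den) (c.num * e.den) ?_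
  have he : (e.den : ℚ) ≠ 0 := by positivity
  have hc : (c.den : ℚ) ≠ 0 := by positivity
  rw [← Rat.num_div_den e, ← Rat.num_div_den c] at h
  field_simp at h
  have : ((e.num * c.den : ℤ) : ℚ) ^ 3 = 4 * ((c.num * e.den : ℤ) : ℚ) ^ 3 +
      4 * m * ((e.den * c.den : ℤ) : ℚ) ^ 3 := by
    push_cast
    linear_combination h
  exact_mod_cast this

lemma exists_place_of_prime {p : ℕ} (hp : p.Prime) :
    ∃ v : HeightOneSpectrum ℤ, v.asIdeal = Ideal.span {(p : ℤ)} :=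
  exists_heightOneSpectrum_of_prime (Nat.prime_iff_prime_int.mp hp)

lemma place_eq_of_mem {v w : HeightOneSpectrum ℤ} {n : ℤ} (hv : v.asIdeal = Ideal.span {n})
    (hw : n ∈ w.asIdeal) : v = w :=
  heightOneSpectrum_eq_of_le (by rwa [hv, Ideal.span_singleton_le_iff_mem])

lemma valuation_int_eq_one {v : HeightOneSpectrum ℤ} {n : ℤ} (h : n ∉ v.asIdeal) :
    v.valuation ℚ (n : ℚ) = 1 :=
  v.valuation_eq_one_iff_notMem.mpr h

/-- A rational number whose valuations at all odd primes are divisible by `3` is a power of `2`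
times a cube. -/
lemma exists_two_pow_mul_cube (u : ℚˣ)
    (h : ∀ v : HeightOneSpectrum ℤ, (2 : ℤ) ∉ v.asIdeal → IsCubeAt v u) :
    ∃ c : ℚ, (u : ℚ) = c ^ 3 ∨ (u : ℚ) = 2 * c ^ 3 ∨ (u : ℚ) = 4 * c ^ 3 := by
  obtain ⟨v₂, hv₂⟩ := exists_place_of_prime Nat.prime_two
  let t : ℚˣ := Units.mk0 2 two_ne_zero
  have ht : (v₂.valuationOfNeZero t).toAdd = -1 := by
    have e := HeightOneSpectrum.valuationOfNeZero_eq v₂ t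
    have e' : v₂.valuation ℚ (t : ℚ) = WithZero.exp (-1 : ℤ) := by
      rw [← v₂.intValuation_singleton (r := 2) (by norm_num) (by exact_mod_cast hv₂)]
      exact v₂.valuation_of_algebraMap (K := ℚ) 2
    rw [e'] at e
    exact WithZero.exp_inj.mp e
  obtain ⟨k, hk3, hk⟩ : ∃ k : ℕ, k < 3 ∧ IsCubeAt v₂ (u * t ^ k) := by
    -- The exponent of the multiplicative valuation is minus the order, so multiplying by 2^k lowers
    -- it by k, and its residue modulo 3 is the right k.
    refine ⟨((v₂.valuationOfNeZero u).toAdd % 3).toNat, by omega,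
      Multiplicative.ofAdd ((v₂.valuationOfNeZero u).toAdd / 3), ?_⟩
    apply Multiplicative.toAdd.injective
    simp only [map_mul, map_pow, toAdd_mul, toAdd_pow, ht, toAdd_ofAdd, nsmul_eq_mul]
    push_cast
    omega
  obtain ⟨ε, c, hc⟩ := exists_unit_mul_cube (R := ℤ) (u * t ^ k) (fun v => by
    by_cases hv : (2 : ℤ) ∈ v.asIdeal
    · rwa [← place_eq_of_mem (v := v₂) (by exact_mod_cast hv₂) hv]
    · refine (h v hv).mul (isCubeAt_of_valuation_eq_one ?_)
      have := valuation_int_eq_one hv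
      push_cast at this
      simp [t, this])
  obtain ⟨d, hd⟩ : ∃ d : ℚ, (u : ℚ) * 2 ^ k = d ^ 3 := by
    have e : (u : ℚ) * 2 ^ k = ((u * t ^ k : ℚˣ) : ℚ) := by simp [t]
    rw [e, hc]
    rcases Int.units_eq_one_or ε with rfl | rfl
    · exact ⟨c, by simp⟩
    · exact ⟨-c, by simp; ring⟩
  interval_cases k
  · exact ⟨d, Or.inl (by linarith)⟩
  · exact ⟨d / 2, Or.inr (Or.inr (by linarith))⟩
  · exact ⟨d / 2, Or.inr (Or.inl (by linarith))⟩

/-- If y - m = 2c³, then (y - m)(y + m) = x³ gives (x/c)³ = 4c³ + 4m. If y - m = 4c³, it gives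
(-2c)³ = 4(-x/(2c))³ + 4m. The value 1/(2m) at (0, m) leads to the same equation with one variable
zero. -/
lemma isCube_descentValue_rat {m : ℤ} (hm : m ≡ 4 [ZMOD 9] ∨ m ≡ -4 [ZMOD 9]) (hm0 : (m : ℚ) ≠ 0)
    (P : (curveA m).Point)
    (h : ∀ v : HeightOneSpectrum ℤ, m ∈ v.asIdeal → (2 : ℤ) ∉ v.asIdeal →
      IsCubeAt v (Units.mk0 (descentValue _ (m : ℚ) P) (descentValue_ne_zero hm0 P))) :
    ∃ c : ℚ, descentValue _ (m : ℚ) P = c ^ 3 := by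
  obtain ⟨c, hc⟩ := exists_two_pow_mul_cube
    (Units.mk0 (descentValue _ (m : ℚ) P) (descentValue_ne_zero hm0 P)) (fun v hv => by
      by_cases hmv : m ∈ v.asIdeal
      · exact h v hmv hv
      · refine isCubeAt_descentValue hm0 (by simp) ?_ P
        rw [map_mul, valuation_int_eq_one hmv]
        have := valuation_int_eq_one hv
        push_cast at this
        simp [this])
  have hc0 := descentValue_ne_zero hm0 P
  rw [Units.val_mk0] at hc
  rcases hc with hc | hc
  · exact ⟨c, hc⟩
  exfalso
  cases P with
  | zero =>
    simp only [descentValue] at hc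
    rcases hc with hc | hc
    -- At O the claim is that 2 and 4 are not rational cubes; this is the same obstruction with m =
    -- 4 and one variable zero.
    · exact rat_cube_ne (m := 4) (Or.inl rfl) 0 (-2 * c) (by push_cast; linear_combination -16 * hc)
    · exact rat_cube_ne (m := 4) (Or.inl rfl) (4 * c) 0 (by push_cast; linear_combination -16 * hc)
  | some x y hxy =>
    have he := equation_mordell hxy.1
    simp only [descentValue, Rat.cast_eq_id, id] at hc hc0
    have hcne : c ≠ 0 := by
      rintro rfl
      rcases hc with hc | hc <;> simp only [hc] at hc0 <;> norm_num at hc0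
    split_ifs at hc with hy
    · field_simp at hc
      rcases hc with hc | hc
      · apply rat_cube_ne hm (1 / c) 0
        field_simp
        linear_combination hc
      · apply rat_cube_ne hm 0 (-1 / (2 * c))
        field_simp
        linear_combination 4 * hc
    · have he' : (y - m) * (y + m) = x ^ 3 := by linear_combination he
      rcases hc with hc | hc
      · apply rat_cube_ne hm (x / c) c
        field_simp
        linear_combination -he' + (y + m + 2 * c ^ 3) * hc
      · apply rat_cube_ne hm (-2 * c) (-x / (2 * c))
        field_simp
        linear_combination -4 * he' + 4 * (y + m + 4 * c ^ 3) * hc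

lemma mul_modEq_four {a b : ℤ} (ha : a ≡ 2 [ZMOD 9] ∨ a ≡ -2 [ZMOD 9])
    (hb : b ≡ 2 [ZMOD 9] ∨ b ≡ -2 [ZMOD 9]) : a * b ≡ 4 [ZMOD 9] ∨ a * b ≡ -4 [ZMOD 9] := by
  rcases ha with ha | ha <;> rcases hb with hb | hb
  · exact Or.inl (ha.mul hb)
  · exact Or.inr (ha.mul hb)
  · exact Or.inr (ha.mul hb)
  · exact Or.inl (ha.mul hb)

/-- The image of `α` embeds in `(ℤ/3ℤ)²` by the valuations at `p` and `q`. -/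
lemma exists_injective_range_alpha {p q : ℕ} (hp : p.Prime) (hq : q.Prime)
    (h : (p * q : ℤ) ≡ 4 [ZMOD 9] ∨ (p * q : ℤ) ≡ -4 [ZMOD 9]) :
    ∃ g : (alpha (p * q) (mul_primes_ne_zero hp hq)).range →+ ZMod 3 × ZMod 3,
      Function.Injective g := by
  obtain ⟨v, hv⟩ := exists_place_of_prime hp
  obtain ⟨w, hw⟩ := exists_place_of_prime hq
  refine ⟨((valuationModThree _ v).prod (valuationModThree _ w)).comp (AddSubgroup.subtype _),
    (injective_iff_map_eq_zero _).mpr ?_⟩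
  rintro ⟨_, P, rfl⟩ hP
  obtain ⟨h₁, h₂⟩ := Prod.mk.inj hP
  replace h₁ := (valuationModThree_eq_zero_iff v _).mp h₁
  replace h₂ := (valuationModThree_eq_zero_iff w _).mp h₂
  have hpq : (((p * q : ℤ) : ℤ) : ℚ) ≠ 0 := by exact_mod_cast mul_primes_ne_zero hp hq
  obtain ⟨c, hc⟩ := isCube_descentValue_rat h hpq P
    (fun z hz _ => by
      rcases z.isPrime.mem_or_mem hz with hz | hz
      · rw [← place_eq_of_mem hv hz]
        exact h₁
      · rw [← place_eq_of_mem hw hz]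
        exact h₂)
  exact Subtype.ext (congrArg Additive.ofMul (Subtype.ext (descentClass_eq_one_of_cube hpq P hc)))

lemma three_nsmul_classGroupS3 {R F : Type*} [CommRing R] [IsDedekindDomain R] [Field F]
    [Algebra R F] [IsFractionRing R F] {m : ℤ} (x : Additive (classGroupS3 R F m)) : 3 • x = 0 := by
  obtain ⟨⟨u, hu⟩, rfl⟩ := Additive.ofMul.surjective x
  induction u using QuotientGroup.induction_on with
  | H u =>
    exact congrArg Additive.ofMul (Subtype.ext ((QuotientGroup.eq_one_iff _).mpr ⟨u, rfl⟩))

/-- The image of `α` contains `ℤ/3ℤ`, generated by the image of `(0, m)`. -/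
lemma exists_injective_to_range_alpha {m : ℤ} (hm : m ≠ 0) (hodd : Odd m) :
    ∃ f : ZMod 3 →+ (alpha m hm).range, Function.Injective f := by
  have hmQ : (m : ℚ) ≠ 0 := by exact_mod_cast hm
  have hns : (curveA m).Nonsingular 0 m := by
    rw [WeierstrassCurve.Affine.nonsingular_iff, WeierstrassCurve.Affine.equation_iff]
    refine ⟨by simp, Or.inr ?_⟩
    simp only [zero_mul, sub_zero]
    intro h
    exact hmQ (by linarith)
  let P : (curveA m).Point := .some 0 m hns
  have hP : alpha m hm P ≠ 0 := by
    intro h0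
    obtain ⟨v, hv⟩ := exists_place_of_prime Nat.prime_two
    have h := (valuationModThree_eq_zero_iff v _).mp
      ((congrArg (valuationModThree m v) h0).trans (map_zero _))
    obtain ⟨z, hz⟩ := h
    have e := HeightOneSpectrum.valuationOfNeZero_eq v
      (Units.mk0 (descentValue _ (m : ℚ) P) (descentValue_ne_zero hmQ P))
    rw [hz] at e
    have hm2 : m ∉ v.asIdeal := by
      rw [hv, Ideal.mem_span_singleton]
      obtain ⟨k, rfl⟩ := hodd
      push_cast
      omega
    have e2 : v.valuation ℚ (2 : ℚ) = WithZero.exp (-1 : ℤ) := by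
      rw [← v.intValuation_singleton (r := 2) (by norm_num) (by exact_mod_cast hv)]
      exact v.valuation_of_algebraMap (K := ℚ) 2
    have e3 : descentValue _ (m : ℚ) P = 1 / (2 * m) := by simp [descentValue, P]
    rw [Units.val_mk0, e3, map_div₀, map_mul, valuation_int_eq_one hm2, e2, mul_one, map_one,
      one_div, ← WithZero.exp_neg] at e
    -- The valuation of 1/(2m) at 2 has exponent 1, which is not a multiple of 3.
    have e4 := congrArg Multiplicative.toAdd (WithZero.coe_inj.mp e)
    rw [toAdd_pow, nsmul_eq_mul] at e4
    change _ = (-(-1) : ℤ) at e4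
    push_cast at e4
    omega
  let a : (alpha m hm).range := ⟨_, P, rfl⟩
  have ha : a ≠ 0 := fun h => hP (congrArg Subtype.val h)
  have h3 : (3 : ℕ) • a = 0 := Subtype.ext (three_nsmul_classGroupS3 _)
  refine ⟨ZMod.lift 3 ⟨zmultiplesHom _ a, (natCast_zsmul a 3).trans h3⟩, (ZMod.lift_injective _).mpr ?_⟩
  intro k hk
  rw [ZMod.intCast_zmod_eq_zero_iff_dvd]
  rw [zmultiplesHom_apply] at hk
  have := addOrderOf_eq_prime h3 ha
  rw [← this]
  exact addOrderOf_dvd_iff_zsmul_eq_zero.mpr hk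

end Rational

/-! ### The 2-adic obstruction, and traces and norms of integers of ℚ(√-3). -/

section Eisenstein

open NumberField

/-- The form A³ + A²B + B³ has no nontrivial zero over 𝔽₂, so A and B are even. Then 8 divides 6mC³,
and C is even because m is odd. -/
lemma two_dvd_of_binary_cubic_eq {m A B C : ℤ} (hm : Odd m)
    (h : A ^ 3 - 3 * A ^ 2 * B + B ^ 3 = 6 * m * C ^ 3) : 2 ∣ A ∧ 2 ∣ B ∧ 2 ∣ C := by
  have key : ∀ a b : ZMod 2, a ^ 3 - 3 * a ^ 2 * b + b ^ 3 = 0 → a = 0 ∧ b = 0 := by decide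
  have h6 : (6 : ZMod 2) = 0 := rfl
  have h2 : (A : ZMod 2) ^ 3 - 3 * A ^ 2 * B + B ^ 3 = 0 := by
    have := congrArg (Int.cast : ℤ → ZMod 2) h
    push_cast at this
    rw [this, h6, zero_mul, zero_mul]
  obtain ⟨ha, hb⟩ := key _ _ h2
  rw [ZMod.intCast_zmod_eq_zero_iff_dvd] at ha hb
  refine ⟨ha, hb, ?_⟩
  obtain ⟨a, rfl⟩ := ha
  obtain ⟨b, rfl⟩ := hb
  have h3 : (2 : ℤ) ∣ (3 * m) * C ^ 3 :=
    ⟨2 * (a ^ 3 - 3 * a ^ 2 * b + b ^ 3), by push_cast at h; linarith⟩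
  rcases Int.prime_two.dvd_or_dvd h3 with h3 | h3
  · obtain ⟨k, rfl⟩ := hm
    omega
  · exact Int.prime_two.dvd_of_dvd_pow h3

lemma int_binary_cubic_ne {m : ℤ} (hm : Odd m) (C : ℤ) (hC : C ≠ 0) (A B : ℤ) :
    A ^ 3 - 3 * A ^ 2 * B + B ^ 3 ≠ 6 * m * C ^ 3 := by
  induction hn : C.natAbs using Nat.strong_induction_on generalizing C A B with
  | _ n ih =>
    intro h
    obtain ⟨⟨A, rfl⟩, ⟨B, rfl⟩, ⟨C, rfl⟩⟩ := two_dvd_of_binary_cubic_eq hm h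
    exact ih C.natAbs (by omega) C (by omega) A B rfl (by linarith)

lemma rat_binary_cubic_ne {m : ℤ} (hm : Odd m) (a b : ℚ) :
    a ^ 3 - 3 * a ^ 2 * b + b ^ 3 ≠ 6 * m := by
  intro h
  refine int_binary_cubic_ne hm (a.den * b.den) (by positivity) (a.num * b.den) (b.num * a.den) ?_
  have ha : (a.den : ℚ) ≠ 0 := by positivity
  have hb : (b.den : ℚ) ≠ 0 := by positivity
  rw [← Rat.num_div_den a, ← Rat.num_div_den b] at h
  field_simp at h
  have : ((a.num * b.den : ℤ) : ℚ) ^ 3 - 3 * ((a.num * b.den : ℤ) : ℚ) ^ 2 *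
      ((b.num * a.den : ℤ) : ℚ) + ((b.num * a.den : ℤ) : ℚ) ^ 3 =
      6 * m * ((a.den * b.den : ℤ) : ℚ) ^ 3 := by
    push_cast
    linear_combination h
  exact_mod_cast this

/-- A square root t of -3 would make (t - 1)/2 a root of z² + z + 1. Then z³ = 1, but 3 is coprime
to l - 1, so z = 1 and 3 = 0. -/
lemma sq_ne_neg_three {l : ℕ} (hl : l.Prime) (h2 : l ≠ 2) (h : l ≡ 2 [MOD 3]) (t : ZMod l) :
    t ^ 2 ≠ -3 := by
  have := Fact.mk hl
  intro ht
  have two_ne : (2 : ZMod l) ≠ 0 := by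
    intro h0
    have : ((2 : ℕ) : ZMod l) = 0 := by exact_mod_cast h0
    rw [ZMod.natCast_eq_zero_iff] at this
    exact h2 ((Nat.prime_dvd_prime_iff_eq hl Nat.prime_two).mp this)
  have three_ne : (3 : ZMod l) ≠ 0 := by
    intro h0
    have : ((3 : ℕ) : ZMod l) = 0 := by exact_mod_cast h0
    rw [ZMod.natCast_eq_zero_iff, Nat.prime_dvd_prime_iff_eq hl Nat.prime_three] at this
    subst this
    exact absurd h (by decide)
  set z : ZMod l := (t - 1) / 2 with hz
  have hz' : 2 * z = t - 1 := by rw [hz]; field_simp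
  have hq : z ^ 2 + z + 1 = 0 := by
    have : (2 : ZMod l) ^ 2 * (z ^ 2 + z + 1) = 0 := by
      linear_combination ht + (2 * z + t + 1) * hz'
    exact (mul_eq_zero.mp this).resolve_left (pow_ne_zero 2 two_ne)
  have h3 : z ^ 3 = 1 := by linear_combination (z - 1) * hq
  have z0 : z ≠ 0 := by
    rintro h0
    rw [h0] at h3
    norm_num at h3
  have hc : Nat.gcd 3 (l - 1) = 1 := by
    refine (Nat.Prime.coprime_iff_not_dvd Nat.prime_three).mpr fun hd => ?_
    change l % 3 = 2 at h
    omega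
  have h1 : z ^ Nat.gcd 3 (l - 1) = 1 := pow_gcd_eq_one.mpr ⟨h3, ZMod.pow_card_sub_one_eq_one z0⟩
  rw [hc, pow_one] at h1
  rw [h1] at hq
  exact three_ne (by linear_combination hq)

/-- For odd l ≡ 2 modulo 3, -3 is a nonresidue, so T² + 3S² vanishes modulo l only if S and T do. -/
lemma dvd_of_four_mul_eq {l : ℕ} (hl : l.Prime) (h : l = 3 ∨ l ≡ 2 [MOD 3]) {N T S : ℤ}
    (hN : (l : ℤ) ∣ N) (he : 4 * N = T ^ 2 + 3 * S ^ 2) : (l : ℤ) ∣ T := by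
  have hl' := Nat.prime_iff_prime_int.mp hl
  have := Fact.mk hl
  rcases h with rfl | h
  · exact hl'.dvd_of_dvd_pow (n := 2) (by push_cast at *; omega)
  by_cases h2 : l = 2
  · subst h2
    obtain ⟨n, rfl⟩ := hN
    -- With N even the right side vanishes modulo 8; 4t = 0 there says that t is even.
    have key : ∀ t s : ZMod 8, t ^ 2 + 3 * s ^ 2 = 0 → 4 * t = 0 := by decide
    have h8 : (8 : ZMod 8) = 0 := rfl
    have e := congrArg (Int.cast : ℤ → ZMod 8) he
    push_cast at e
    have e2 := key T S (by rw [← e]; linear_combination n * h8)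
    have e3 : ((4 * T : ℤ) : ZMod 8) = 0 := by push_cast; exact e2
    rw [ZMod.intCast_zmod_eq_zero_iff_dvd] at e3
    push_cast at *
    omega
  · have hd : (l : ℤ) ∣ T ^ 2 + 3 * S ^ 2 := he ▸ hN.mul_left 4
    have e : (T : ZMod l) ^ 2 + 3 * (S : ZMod l) ^ 2 = 0 := by
      have := (ZMod.intCast_zmod_eq_zero_iff_dvd _ l).mpr hd
      exact_mod_cast this
    have hS : (S : ZMod l) = 0 := by
      by_contra hS
      apply sq_ne_neg_three hl h2 h (T / S)
      field_simp
      linear_combination e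
    rw [← ZMod.intCast_zmod_eq_zero_iff_dvd]
    rw [hS] at e
    exact pow_eq_zero_iff two_ne_zero |>.mp (by linear_combination e)

/-- Conjugation on `ℚ(√-3)`. -/
noncomputable def conj : QuadField ≃+* QuadField := starRingAut

/-- Conjugation on the ring of integers of `ℚ(√-3)`. -/
noncomputable def conjInt : 𝓞 QuadField ≃+* 𝓞 QuadField := RingOfIntegers.mapRingEquiv conj

lemma conj_re (x : QuadField) : (conj x).re = x.re := by
  change (star x).re = x.re
  simp

lemma conj_im (x : QuadField) : (conj x).im = -x.im := rfl

lemma exists_int_eq_of_isIntegral {r : ℚ} {x : QuadField} (hx : IsIntegral ℤ x)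
    (h : x = ⟨r, 0⟩) : ∃ n : ℤ, (n : ℚ) = r := by
  have e : x = algebraMap ℚ QuadField r := by
    rw [h]
    ext <;> simp
  rw [e, isIntegral_algebraMap_iff (algebraMap ℚ QuadField).injective] at hx
  obtain ⟨n, hn⟩ := IsIntegrallyClosed.isIntegral_iff.mp hx
  exact ⟨n, by simpa using hn⟩

/-- For x = a + b√-3 one has T = 2a, N = a² + 3b² and S = ±2b. This replaces an explicit integral
basis. -/
lemma exists_trace_norm (x : 𝓞 QuadField) : ∃ T N S : ℤ, x + conjInt x = T ∧ x * conjInt x = N ∧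
    4 * N = T ^ 2 + 3 * S ^ 2 := by
  set X : QuadField := (x : QuadField) with hX
  have hx : IsIntegral ℤ X := RingOfIntegers.isIntegral_coe x
  have hx' : IsIntegral ℤ (conj X) := RingOfIntegers.isIntegral_coe (conjInt x)
  have hcast (n : ℤ) : ((n : 𝓞 QuadField) : QuadField) = n := map_intCast (algebraMap _ _) n
  have hsq : IsIntegral ℤ sqrtNegThree := by
    refine IsIntegral.of_pow (n := 2) (by norm_num) ?_
    rw [sqrtNegThree_sq]
    exact_mod_cast isIntegral_algebraMap (R := ℤ) (x := (-3 : ℤ)) (A := QuadField)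
  obtain ⟨T, hT⟩ := exists_int_eq_of_isIntegral (r := 2 * X.re) (hx.add hx') (by
    ext
    · simp only [QuadraticAlgebra.re_add, conj_re]; ring
    · simp only [QuadraticAlgebra.im_add, conj_im]; ring)
  obtain ⟨N, hN⟩ := exists_int_eq_of_isIntegral (r := X.re ^ 2 + 3 * X.im ^ 2) (hx.mul hx') (by
    ext
    · simp only [QuadraticAlgebra.re_mul, conj_re, conj_im]; ring
    · simp only [QuadraticAlgebra.im_mul, conj_re, conj_im]; ring)
  -- The integer -6b is √-3 times the difference of x and its conjugate; its square is 3(4N - T²),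
  -- so it is divisible by 3.
  obtain ⟨k, hk⟩ := exists_int_eq_of_isIntegral (r := -6 * X.im) (hsq.mul (hx.sub hx')) (by
    ext
    · simp [conj_re, conj_im]; ring
    · simp [conj_re, conj_im])
  have e : k ^ 2 = 3 * (4 * N - T ^ 2) := by
    have : (k : ℚ) ^ 2 = 3 * (4 * N - T ^ 2) := by
      rw [hk, hN, hT]; ring
    exact_mod_cast this
  obtain ⟨S, rfl⟩ := Int.prime_three.dvd_of_dvd_pow (Dvd.intro _ e.symm)
  refine ⟨T, N, S, ?_, ?_, by linarith⟩
  · apply RingOfIntegers.ext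
    change X + conj X = ((T : 𝓞 QuadField) : QuadField)
    rw [hcast]
    ext
    · simp [conj_re, hT]; ring
    · simp [conj_im]
  · apply RingOfIntegers.ext
    change X * conj X = ((N : 𝓞 QuadField) : QuadField)
    rw [hcast]
    ext
    · simp [conj_re, conj_im, hN]; ring
    · simp [conj_re, conj_im]; ring

end Eisenstein

/-! ### Conjugation acting on places of K. -/

section Conjugation

open NumberField

lemma intValuation_ringEquiv {R : Type*} [CommRing R] [IsDedekindDomain R] (e : R ≃+* R)
    {v w : HeightOneSpectrum R} (h : w.asIdeal = v.asIdeal.comap (e : R →+* R)) (r : R) :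
    v.intValuation (e r) = w.intValuation r := by
  by_cases hr : r = 0
  · simp [hr]
  have hmem (n : ℕ) : e r ∈ v.asIdeal ^ n ↔ r ∈ w.asIdeal ^ n := by
    have h1 : w.asIdeal = v.asIdeal.map (e.symm : R →+* R) := by
      rw [h]
      exact (Ideal.map_symm e).symm
    rw [h1, ← Ideal.map_pow]
    have h2 : (v.asIdeal ^ n).map (e.symm : R →+* R) = (v.asIdeal ^ n).comap (e : R →+* R) :=
      Ideal.map_symm e
    rw [h2]
    rfl
  have hle (n : ℕ) : v.intValuation (e r) ≤ WithZero.exp (-(n : ℤ)) ↔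
      w.intValuation r ≤ WithZero.exp (-(n : ℤ)) := by
    rw [v.intValuation_le_pow_iff_mem, w.intValuation_le_pow_iff_mem, hmem]
  have e1 := v.intValuation_eq_exp_neg_multiplicity (r := e r) (by simpa using hr)
  have e2 := w.intValuation_eq_exp_neg_multiplicity hr
  refine le_antisymm ?_ ?_
  · rw [e2, hle, e2]
  · rw [e1, ← hle, e1]

lemma valuation_conj {v w : HeightOneSpectrum (𝓞 QuadField)}
    (h : w.asIdeal = v.asIdeal.comap (conjInt : 𝓞 QuadField →+* 𝓞 QuadField)) (x : QuadField) :
    v.valuation QuadField (conj x) = w.valuation QuadField x := by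
  obtain ⟨a, b, hb, rfl⟩ := IsFractionRing.div_surjective (A := 𝓞 QuadField) x
  have e (r : 𝓞 QuadField) : v.valuation QuadField (conj (algebraMap _ QuadField r)) =
      w.valuation QuadField (algebraMap _ QuadField r) := by
    rw [w.valuation_of_algebraMap, ← intValuation_ringEquiv conjInt h,
      ← v.valuation_of_algebraMap (K := QuadField)]
    rfl
  rw [map_div₀, map_div₀, map_div₀, e, e]

lemma intCast_dvd_of_mem {R : Type*} [CommRing R] {I : Ideal R} (hI : I ≠ ⊤) {l : ℕ}
    (hl : l.Prime) (h : ((l : ℤ) : R) ∈ I) {n : ℤ} (hn : (n : R) ∈ I) : (l : ℤ) ∣ n := by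
  by_contra hd
  obtain ⟨a, b, hab⟩ := (Nat.prime_iff_prime_int.mp hl).coprime_iff_not_dvd.mpr hd
  apply hI
  rw [Ideal.eq_top_iff_one]
  have := congrArg (Int.cast : ℤ → R) hab
  push_cast at this
  rw [← this]
  refine I.add_mem (I.mul_mem_left _ ?_) (I.mul_mem_left _ hn)
  exact_mod_cast h

lemma conjInt_conjInt (x : 𝓞 QuadField) : conjInt (conjInt x) = x := by
  apply RingOfIntegers.ext
  exact star_star (x : QuadField)

/-- If x lies in v, its norm is divisible by l, hence so is its trace T, and the conjugate T - x
lies in v. -/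
lemma comap_conjInt_eq {v : HeightOneSpectrum (𝓞 QuadField)} {l : ℕ} (hl : l.Prime)
    (h : l = 3 ∨ l ≡ 2 [MOD 3]) (hv : ((l : ℤ) : 𝓞 QuadField) ∈ v.asIdeal) :
    v.asIdeal = v.asIdeal.comap (conjInt : 𝓞 QuadField →+* 𝓞 QuadField) := by
  have hle : v.asIdeal ≤ v.asIdeal.comap (conjInt : 𝓞 QuadField →+* 𝓞 QuadField) := by
    intro x hx
    obtain ⟨T, N, S, hT, hN, he⟩ := exists_trace_norm x
    have hd := intCast_dvd_of_mem v.isPrime.ne_top hl hv (n := N)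
      (hN ▸ v.asIdeal.mul_mem_right _ hx)
    obtain ⟨k, hk⟩ := dvd_of_four_mul_eq hl h hd he
    change conjInt x ∈ v.asIdeal
    rw [eq_sub_of_add_eq' hT, hk, Int.cast_mul]
    exact v.asIdeal.sub_mem (v.asIdeal.mul_mem_right _ hv) hx
  refine le_antisymm hle fun x hx => ?_
  have := hle hx
  change conjInt (conjInt x) ∈ v.asIdeal at this
  rwa [conjInt_conjInt] at this

/-- For x in v, l divides the norm of x, so x or its conjugate lies in w. Prime avoidance and
maximality conclude. -/
lemma eq_or_eq_comap_conjInt {v w : HeightOneSpectrum (𝓞 QuadField)} {l : ℕ} (hl : l.Prime)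
    (hv : ((l : ℤ) : 𝓞 QuadField) ∈ v.asIdeal) (hw : ((l : ℤ) : 𝓞 QuadField) ∈ w.asIdeal) :
    v = w ∨ v.asIdeal = w.asIdeal.comap (conjInt : 𝓞 QuadField →+* 𝓞 QuadField) := by
  have hsub : (v.asIdeal : Set (𝓞 QuadField)) ⊆ (w.asIdeal : Set (𝓞 QuadField)) ∪
      (w.asIdeal.comap (conjInt : 𝓞 QuadField →+* 𝓞 QuadField) : Set (𝓞 QuadField)) := by
    intro x hx
    obtain ⟨T, N, S, -, hN, -⟩ := exists_trace_norm x
    obtain ⟨k, hk⟩ := intCast_dvd_of_mem v.isPrime.ne_top hl hv (n := N)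
      (hN ▸ v.asIdeal.mul_mem_right _ hx)
    refine w.isPrime.mem_or_mem (x := x) (y := conjInt x) ?_
    rw [hN, hk, Int.cast_mul]
    exact w.asIdeal.mul_mem_right _ hw
  rcases Ideal.subset_union.mp hsub with h | h
  · exact Or.inl (heightOneSpectrum_eq_of_le h)
  · exact Or.inr (v.isMaximal.eq_of_le (w.asIdeal.comap_isPrime _).ne_top h)

/-- An inverse of l would have integral norm N with Nl² = 1. -/
lemma exists_place_over {l : ℕ} (hl : l.Prime) :
    ∃ v : HeightOneSpectrum (𝓞 QuadField), ((l : ℤ) : 𝓞 QuadField) ∈ v.asIdeal := by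
  have hne : Ideal.span {((l : ℤ) : 𝓞 QuadField)} ≠ ⊤ := by
    rw [Ne, Ideal.span_singleton_eq_top]
    rintro hu
    obtain ⟨x, hx⟩ := hu.exists_left_inv
    obtain ⟨T, N, S, -, hN, -⟩ := exists_trace_norm x
    have h1 : ((N * (l * l) : ℤ) : 𝓞 QuadField) = 1 := by
      have hx' := congrArg conjInt hx
      rw [map_mul, map_one, map_intCast] at hx'
      push_cast at hx hx' ⊢
      rw [← hN]
      linear_combination (conjInt x * l) * hx + hx'
    have h2 : N * (l * l) = 1 := by exact_mod_cast h1
    have h3 : (l : ℤ) ∣ 1 := ⟨N * l, by linarith⟩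
    exact hl.one_lt.ne' (by exact_mod_cast Int.eq_one_of_dvd_one (by positivity) h3)
  obtain ⟨M, hM, hle⟩ := Ideal.exists_le_maximal _ hne
  have hmem : ((l : ℤ) : 𝓞 QuadField) ∈ M := hle (Ideal.mem_span_singleton_self _)
  refine ⟨⟨M, hM.isPrime, ?_⟩, hmem⟩
  rintro rfl
  rw [Ideal.mem_bot] at hmem
  exact hl.ne_zero (by exact_mod_cast hmem)

/-! ### Units of ℚ(ζ₃) and the image of α'. -/

/-- The primitive cube root of unity `(-1 + √-3) / 2`. -/
def zetaThree : QuadField := ⟨-1 / 2, 1 / 2⟩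

lemma zetaThree_sq : zetaThree ^ 2 = ⟨-1 / 2, -1 / 2⟩ := by
  ext <;> simp [zetaThree, pow_two] <;> norm_num

lemma zetaThree_isPrimitiveRoot : IsPrimitiveRoot zetaThree 3 := by
  refine IsPrimitiveRoot.mk_of_lt _ (by norm_num) ?_ fun l hl hl3 h => ?_
  · rw [pow_succ, zetaThree_sq]
    ext <;> simp [zetaThree, QuadraticAlgebra.re_one, QuadraticAlgebra.im_one] <;> norm_num
  · have him := congrArg QuadraticAlgebra.im h
    interval_cases l
    · simp [zetaThree, QuadraticAlgebra.im_one] at him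
    · rw [zetaThree_sq] at him
      norm_num [QuadraticAlgebra.im_one] at him

instance isCyclotomicExtensionQuadField : IsCyclotomicExtension {3} ℚ QuadField := by
  rw [IsCyclotomicExtension.iff_singleton]
  refine ⟨⟨_, zetaThree_isPrimitiveRoot⟩, fun x => ?_⟩
  have e : x = algebraMap ℚ QuadField (x.re + x.im) + algebraMap ℚ QuadField (2 * x.im) * zetaThree := by
    rw [eq_ratCast, eq_ratCast]
    ext <;> simp [zetaThree, QuadraticAlgebra.re_ofNat, QuadraticAlgebra.im_ofNat] <;> ring
  rw [e]
  exact add_mem (algebraMap_mem _ _) (mul_mem (algebraMap_mem _ _)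
    (Algebra.subset_adjoin zetaThree_isPrimitiveRoot.pow_eq_one))

lemma exists_root_mul_cube {u : QuadFieldˣ}
    (h : ∀ v : HeightOneSpectrum (𝓞 QuadField), IsCubeAt v u) :
    ∃ c : QuadField, (u : QuadField) = c ^ 3 ∨ (u : QuadField) = zetaThree * c ^ 3 ∨
      (u : QuadField) = zetaThree ^ 2 * c ^ 3 := by
  have := IsCyclotomicExtension.Rat.three_pid QuadField
  obtain ⟨ε, c, hc⟩ := exists_unit_mul_cube u h
  have hu := IsCyclotomicExtension.Rat.Three.Units.mem zetaThree_isPrimitiveRoot ε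
  simp only [List.mem_cons, List.not_mem_nil, or_false] at hu
  have hneg (a : QuadField) : -a * c ^ 3 = a * (-c) ^ 3 := by ring
  rcases hu with rfl | rfl | rfl | rfl | rfl | rfl
  · exact ⟨c, Or.inl (by rw [hc]; simp)⟩
  · exact ⟨-c, Or.inl (by rw [hc]; simp; ring)⟩
  · exact ⟨c, Or.inr (Or.inl hc)⟩
  · exact ⟨-c, Or.inr (Or.inl (hc.trans (hneg zetaThree)))⟩
  · exact ⟨c, Or.inr (Or.inr hc)⟩
  · exact ⟨-c, Or.inr (Or.inr (hc.trans (hneg (zetaThree ^ 2))))⟩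

lemma cube_re (c : QuadField) : (c ^ 3).re = c.re ^ 3 - 9 * c.re * c.im ^ 2 := by
  simp [pow_succ]
  ring

lemma cube_im (c : QuadField) : (c ^ 3).im = 3 * c.re ^ 2 * c.im - 3 * c.im ^ 3 := by
  simp [pow_succ]
  ring

lemma ne_zetaThree_mul_cube {m : ℤ} (hm : Odd m) {u : QuadField} (hu : u.im = -3 * m)
    (c : QuadField) : u ≠ zetaThree * c ^ 3 := by
  rintro rfl
  -- For c = a + b√-3, twice the √-3-coefficient of ζc³ is a³ - 3a²b - 9ab² + 3b³, which equals A³ -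
  -- 3A²B + B³ for A = a + b, B = 2b.
  apply rat_binary_cubic_ne hm.neg (c.re + c.im) (2 * c.im)
  simp only [QuadraticAlgebra.im_mul, cube_re, cube_im, zetaThree] at hu
  push_cast
  linear_combination 2 * hu

lemma ne_zetaThree_sq_mul_cube {m : ℤ} (hm : Odd m) {u : QuadField} (hu : u.im = -3 * m)
    (c : QuadField) : u ≠ zetaThree ^ 2 * c ^ 3 := by
  rintro rfl
  apply rat_binary_cubic_ne hm (c.re - c.im) (-2 * c.im)
  simp only [QuadraticAlgebra.im_mul, cube_re, cube_im, zetaThree_sq] at hu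
  linear_combination -2 * hu

/-- The image of `α'` embeds in `ℤ/3ℤ` by the valuation at a place above `q`. -/
lemma exists_injective_range_alpha' {p q : ℕ} (hp : p.Prime) (hq : q.Prime) (hp5 : 5 ≤ p)
    (hq5 : 5 ≤ q) (hp3 : p ≡ 2 [MOD 3]) :
    ∃ g : (alpha' (p * q) (mul_primes_ne_zero hp hq)).range →+ ZMod 3, Function.Injective g := by
  obtain ⟨v, hv⟩ := exists_place_over hq
  refine ⟨(valuationModThree _ v).comp (AddSubgroup.subtype _),
    (injective_iff_map_eq_zero _).mpr ?_⟩
  rintro ⟨_, P, rfl⟩ hP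
  replace hP := (valuationModThree_eq_zero_iff v _).mp hP
  have hodd : Odd (p * q : ℤ) := by
    have h1 := hp.odd_of_ne_two (by omega)
    have h2 := hq.odd_of_ne_two (by omega)
    exact_mod_cast h1.mul h2
  have hsel := (Additive.toMul (alpha' (p * q) (mul_primes_ne_zero hp hq) P)).2
  cases P with
  | zero => exact Subtype.ext (map_zero (alpha' (p * q) (mul_primes_ne_zero hp hq)))
  | some x y hxy =>
  have hδ : (3 * ((p * q : ℤ) : QuadField) * sqrtNegThree) ≠ 0 := by
    intro h
    have h0 : ((p * q : ℤ) : ℚ) ≠ 0 := by exact_mod_cast mul_primes_ne_zero hp hq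
    have him := congrArg QuadraticAlgebra.im h
    simp [QuadraticAlgebra.re_ofNat, QuadraticAlgebra.im_ofNat] at him
    exact h0 (by push_cast; simpa using him)
  set u : QuadFieldˣ := Units.mk0 (descentValue _ _ (.some x y hxy)) (descentValue_ne_zero hδ _) with hu
  have hval : (u : QuadField) = (y : QuadField) - 3 * ((p * q : ℤ) : QuadField) * sqrtNegThree := by
    rw [hu, Units.val_mk0, descentValue, if_neg]
    intro h
    have h0 : ((p * q : ℤ) : ℚ) ≠ 0 := by exact_mod_cast mul_primes_ne_zero hp hq
    have him := congrArg QuadraticAlgebra.im h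
    simp [QuadraticAlgebra.re_ofNat, QuadraticAlgebra.im_ofNat] at him
    exact h0 (by push_cast; simpa using him)
  have him : (u : QuadField).im = -3 * (p * q : ℤ) := by
    rw [hval]
    simp [QuadraticAlgebra.re_ofNat, QuadraticAlgebra.im_ofNat]
  have hnorm : (u : QuadField) * conj u = (x : QuadField) ^ 3 := by
    have he := equation_mordell hxy.1
    rw [hval]
    ext
    · simp [conj_re, conj_im, cube_re, QuadraticAlgebra.re_ofNat, QuadraticAlgebra.im_ofNat]
      push_cast at he
      linear_combination he
    · simp [conj_re, conj_im, cube_im, QuadraticAlgebra.re_ofNat, QuadraticAlgebra.im_ofNat]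
      ring
  have huc : conj u ≠ 0 := by simp
  have hcube (w : HeightOneSpectrum (𝓞 QuadField)) : IsCubeAt w u := by
    have hself {l : ℕ} (hl : l.Prime) (h : l = 3 ∨ l ≡ 2 [MOD 3])
        (hw : ((l : ℤ) : 𝓞 QuadField) ∈ w.asIdeal) : IsCubeAt w u :=
      isCubeAt_of_valuation_eq (w := Units.mk0 _ huc) hnorm
        (valuation_conj (comap_conjInt_eq hl h hw) _).symm
    by_cases hw : w ∈ placesDividing (𝓞 QuadField) (p * q)
    · have hw' : ((2 : ℕ) : ℤ) * ((3 : ℕ) : ℤ) * (p * q) = 6 * (p * q : ℤ) := by norm_num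
      change ((6 * (p * q) : ℤ) : 𝓞 QuadField) ∈ w.asIdeal at hw
      rw [← hw', Int.cast_mul, Int.cast_mul, Int.cast_mul] at hw
      rcases w.isPrime.mem_or_mem hw with hw | hw
      · rcases w.isPrime.mem_or_mem hw with hw | hw
        · exact hself Nat.prime_two (Or.inr rfl) hw
        · exact hself Nat.prime_three (Or.inl rfl) hw
      · rcases w.isPrime.mem_or_mem hw with hw | hw
        · exact hself hp (Or.inr hp3) hw
        · rcases eq_or_eq_comap_conjInt hq hw hv with rfl | h
          · exact hP
          -- Here w is the conjugate of v, so the conjugate of u has at w the valuation of u at v;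
          -- the norm relation passes divisibility by 3 back to u.
          · have hc : IsCubeAt w (Units.mk0 _ huc) := by
              obtain ⟨z, hz⟩ := hP
              refine ⟨z, ?_⟩
              rw [← hz, ← WithZero.coe_inj, HeightOneSpectrum.valuationOfNeZero_eq,
                HeightOneSpectrum.valuationOfNeZero_eq]
              have hcc : conj (conj (u : QuadField)) = u := star_star _
              have := valuation_conj h (conj u)
              rw [hcc] at this
              exact this.symm
            exact isCubeAt_of_mul_eq_cube (by rw [mul_comm]; exact hnorm) hc
    · exact (valuationOfNeZeroMod_eq_one_iff w u).mp (hsel w hw)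
  obtain ⟨c, hc | hc | hc⟩ := exists_root_mul_cube hcube
  · exact Subtype.ext (congrArg Additive.ofMul (Subtype.ext (descentClass_eq_one_of_cube hδ _ hc)))
  · exact absurd hc (ne_zetaThree_mul_cube hodd him c)
  · exact absurd hc (ne_zetaThree_sq_mul_cube hodd him c)

end Conjugation

end ThreeDescent

theorem mainTheorem4 (p q : ℕ) (hp : p.Prime) (hq : q.Prime) (hp5 : 5 ≤ p) (hq5 : 5 ≤ q) :
    (((p : ℤ) ≡ 2 [ZMOD 9] ∨ (p : ℤ) ≡ -2 [ZMOD 9]) →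
      ((q : ℤ) ≡ 2 [ZMOD 9] ∨ (q : ℤ) ≡ -2 [ZMOD 9]) →
        (∃ f : ZMod 3 →+
            (ThreeDescent.alpha (p * q) (ThreeDescent.mul_primes_ne_zero hp hq)).range,
          Function.Injective f) ∧
        (∃ g : (ThreeDescent.alpha (p * q) (ThreeDescent.mul_primes_ne_zero hp hq)).range →+
            ZMod 3 × ZMod 3,
          Function.Injective g)) ∧
    (p ≡ 2 [MOD 3] → q ≡ 1 [MOD 3] →
        ∃ g : (ThreeDescent.alpha' (p * q) (ThreeDescent.mul_primes_ne_zero hp hq)).range →+ ZMod 3,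
          Function.Injective g) := by
  refine ⟨fun hp9 hq9 => ⟨?_, ?_⟩, fun hp3 _ => ?_⟩
  · have h1 := hp.odd_of_ne_two (by omega)
    have h2 := hq.odd_of_ne_two (by omega)
    exact ThreeDescent.exists_injective_to_range_alpha _ (by exact_mod_cast h1.mul h2)
  · exact ThreeDescent.exists_injective_range_alpha hp hq (ThreeDescent.mul_modEq_four hp9 hq9)
  · exact ThreeDescent.exists_injective_range_alpha' hp hq hp5 hq5 hp3
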